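/- All graphs are finite and simple. A graph $G$ is called $F$-hom-free if there is no graph homomorphism $F \to G$. For graphs $G,\Gamma$ and $\varepsilon>0$, a map $\varphi : V(G)\to V(\Gamma)$ is an $\varepsilon$-approximate homomorphism if all but at most $\varepsilon |V(G)|^2$ edges of $G$ are mapped by $\varphi$ to edges of $\Gamma$. For graphs $F,H$ such that there is a homomorphism $H \to F$, let $M_{F,H}(\varepsilon)$ be the smallest integer $M$ such that every $H$-hom-free graph has an $\varepsilon$-approximate homomorphism to some $F$-hom-free graph on at most $M$ vertices. Let $\ell \in \{5,7\}$, let $C_\ell$ be the cycle of length $\ell$, and let $K_3$ be the triangle. Then there exist constants $c>0$ and $\varepsilon_0>0$ such that for every $0<\varepsilon<\varepsilon_0$ the number $M_{K_3,C_\ell}(\varepsilon)$ exists and $$M_{K_3,C_\ell}(\varepsilon) \;\ge\; 2^{(1/\varepsilon)^{c}}.$$ -/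

import Mathlib

/-- `G` is `F`-hom-free: there is no graph homomorphism from `F` to `G`. -/
def HomFree {U V : Type*} (F : SimpleGraph U) (G : SimpleGraph V) : Prop :=
  IsEmpty (F →g G)

/-- `φ : V(G) → V(Γ)` is an `ε`-approximate homomorphism: all but at most `ε |V(G)|²` of the
(unordered) edges of `G` are mapped by `φ` to edges of `Γ`. -/
def IsApproxHom {V W : Type*} [Fintype V] (ε : ℝ) (G : SimpleGraph V) (Γ : SimpleGraph W)
    (φ : V → W) : Prop :=
  ({e : Sym2 V | e ∈ G.edgeSet ∧ e.map φ ∉ Γ.edgeSet}.ncard : ℝ) ≤ ε * (Fintype.card V : ℝ) ^ 2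

/-- The set of all natural numbers `M` such that every finite `H`-hom-free graph has an
`ε`-approximate homomorphism to an `F`-hom-free graph on at most `M` vertices. -/
def approxHomBounds {A B : Type*} (F : SimpleGraph A) (H : SimpleGraph B) (ε : ℝ) : Set ℕ :=
  {M : ℕ | ∀ (V : Type) [Fintype V] (G : SimpleGraph V), HomFree H G →
    ∃ (W : Type) (_ : Fintype W) (Γ : SimpleGraph W),
      HomFree F Γ ∧ Fintype.card W ≤ M ∧ ∃ φ : V → W, IsApproxHom ε G Γ φ}

/-- `M_{F,H}(ε)`, the smallest `M` such that every finite `H`-hom-free graph has an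
`ε`-approximate homomorphism to an `F`-hom-free graph on at most `M` vertices.
If there were no such `M` at all, the value would be `0`; hence a positive lower bound on
`approxHomNumber F H ε` includes the claim that such an `M` exists. -/
noncomputable def approxHomNumber {A B : Type*} (F : SimpleGraph A) (H : SimpleGraph B)
    (ε : ℝ) : ℕ :=
  sInf (approxHomBounds F H ε)

/-!
The number exists because `C₅`- or `C₇`-hom-free graphs are triangle-free: mapping each vertex to
its part in a regularity partition is an approximate homomorphism to the reduced graph, which is
triangle-free by the counting lemma (`exists_isApproxHom_of_cliqueFree`).

For the lower bound, a single graph serves both lengths, as `C₇` maps to `C₅`. Take a tripartite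
linear 3-uniform hypergraph in which every vertex lies in `q` hyperedges, with `q⁶` hyperedges in
total. Blow up each vertex into `2 ^ q` copies, one for each way of choosing, in every hyperedge
through it, one of its two companions; join two copies if each has chosen the other
(`choiceGraph`). No walk goes around a hyperedge directly, so a short odd closed walk would need a
short cycle of the hypergraph. The hypergraph consists of the lines in three directions in the free
nilpotent group of class two on three generators over a field with `q` elements. It has short
cycles, but none of them gives a closed walk of length seven (`not_closed_walk`): the changes in
each direction and their commutators have to cancel separately.

Now map this graph to a triangle-free graph with fewer than `exp (c q)` vertices. A colouring of
the cube `{0, 1} ^ q` with so few colours hardly depends on most coordinates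
(`sum_abs_card_sub_card_le`). So for a typical hyperedge, each of its three vertices has copies
choosing one companion and copies choosing the other with nearly the same distribution of images.
If almost all edges at this hyperedge were preserved, three random images would form a triangle
(`sq_le_sum_nonadj`). Hence a constant proportion of the edges is lost, which is a proportion of
order `q⁻⁴` of the square of the number of vertices (`one_le_of_isApproxHom`). Choosing `q` to be a
prime of order `ε ^ (-1 / 4)` gives the bound.
-/

/-! ### Existence of a bound -/

open Finset in
/-- The regularity partition of a triangle-free graph gives an approximate homomorphism: its
reduced graph is triangle-free by the triangle counting lemma, and few edges of the graph lie
outside dense regular pairs. -/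
theorem exists_isApproxHom_of_cliqueFree {ε : ℝ} (hε : 0 < ε) (hε1 : ε ≤ 1) (V : Type)
    [Fintype V] (G : SimpleGraph V) (hG : G.CliqueFree 3) :
    ∃ (W : Type) (_ : Fintype W) (Γ : SimpleGraph W), Γ.CliqueFree 3 ∧
      Fintype.card W ≤ max ⌈4 / ε⌉₊ (SzemerediRegularity.bound (ε / 8) ⌈4 / ε⌉₊) ∧
      ∃ φ : V → W, IsApproxHom ε G Γ φ := by
  classical
  rcases lt_or_ge (Fintype.card V) ⌈4 / ε⌉₊ with hV | hV
  · refine ⟨V, inferInstance, G, hG, le_max_of_le_left hV.le, id, ?_⟩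
    have : {e : Sym2 V | e ∈ G.edgeSet ∧ e.map id ∉ G.edgeSet} = ∅ := by
      ext e; simp
    rw [IsApproxHom, this]
    simp only [Set.ncard_empty, Nat.cast_zero]
    positivity
  obtain ⟨P, hP₁, hP₂, hP₃, hP₄⟩ := szemeredi_regularity G (by positivity : 0 < ε / 8) hV
  have hpos : 0 < ⌈4 / ε⌉₊ := Nat.ceil_pos.2 (by positivity)
  have : Nonempty V := Fintype.card_pos_iff.1 (hpos.trans_le hV)
  have h4 : 4 / ε ≤ #P.parts := (Nat.le_ceil _).trans (Nat.cast_le.2 hP₂)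
  have key := SimpleGraph.regularityReduced_edges_card_aux hε hP₁ hP₄ h4
  set R := G.regularityReduced P (ε / 8) (ε / 4) with hR
  let Γ : SimpleGraph P.parts :=
    { Adj := fun A B ↦ A ≠ B ∧ G.IsUniform (ε / 8) A.1 B.1 ∧ ε / 4 ≤ G.edgeDensity A.1 B.1
      symm := ⟨by
        rintro A B ⟨h, hu, hd⟩
        refine ⟨h.symm, hu.symm, ?_⟩
        rwa [SimpleGraph.edgeDensity_comm]⟩
      loopless := ⟨fun A h ↦ h.1 rfl⟩ }
  refine ⟨P.parts, inferInstance, Γ, ?_, ?_, fun v ↦ ⟨P.part v, P.part_mem.2 (mem_univ v)⟩, ?_⟩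
  · intro s hs
    obtain ⟨X, Y, Z, hXY, hXZ, hYZ, -⟩ := SimpleGraph.is3Clique_iff.1 hs
    have e : 2 * (ε / 8) = ε / 4 := by ring
    have disj : ∀ {A B : P.parts}, A ≠ B → Disjoint (A : Finset V) B := fun {A B} h ↦
      P.disjoint A.2 B.2 (fun h' ↦ h (Subtype.ext h'))
    have cnt := SimpleGraph.triangle_counting G (ε := ε / 8) (s := X.1) (t := Y.1) (u := Z.1)
      (by rw [e]; exact hXY.2.2) hXY.2.1 (disj hXY.1) (by rw [e]; exact hXZ.2.2) hXZ.2.1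
      (disj hXZ.1) (by rw [e]; exact hYZ.2.2) hYZ.2.1 (disj hYZ.1)
    rw [SimpleGraph.cliqueFinset_eq_empty_iff.2 hG] at cnt
    have hc : ∀ A : P.parts, (0 : ℝ) < #A.1 := fun A ↦
      Nat.cast_pos.2 (P.nonempty_of_mem_parts A.2).card_pos
    have h1 := hc X
    have h2 := hc Y
    have h3 := hc Z
    have h5 : 0 < 1 - 2 * (ε / 8) := by linarith
    have : 0 < (1 - 2 * (ε / 8)) * (ε / 8) ^ 3 * #X.1 * #Y.1 * #Z.1 := by positivity
    simp only [card_empty, Nat.cast_zero] at cnt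
    linarith
  · rw [Fintype.card_coe]
    exact le_max_of_le_right hP₃
  · have hle : R ≤ G := SimpleGraph.regularityReduced_le
    have hsub : {e : Sym2 V | e ∈ G.edgeSet ∧ e.map
        (fun v ↦ (⟨P.part v, P.part_mem.2 (mem_univ v)⟩ : P.parts)) ∉ Γ.edgeSet} ⊆
        ((G.edgeFinset \ R.edgeFinset : Finset (Sym2 V)) : Set (Sym2 V)) := by
      intro e
      induction e with | _ x y
      rintro ⟨hxy, hn⟩
      rw [SimpleGraph.mem_edgeSet] at hxy
      simp only [coe_sdiff, SimpleGraph.coe_edgeFinset, Set.mem_sdiff, SimpleGraph.mem_edgeSet]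
      refine ⟨hxy, fun hr ↦ hn ?_⟩
      obtain ⟨-, U, hU, W, hW, hxU, hyW, hUW, hu, hd⟩ := hr
      have e1 : P.part x = U := P.eq_of_mem_parts (P.part_mem.2 (mem_univ x)) hU
        (P.mem_part (mem_univ x)) hxU
      have e2 : P.part y = W := P.eq_of_mem_parts (P.part_mem.2 (mem_univ y)) hW
        (P.mem_part (mem_univ y)) hyW
      subst e1 e2
      exact ⟨fun h ↦ hUW (congrArg Subtype.val h), hu, hd⟩
    have h1 := Set.ncard_le_ncard hsub (Finset.finite_toSet _)
    rw [Set.ncard_coe_finset] at h1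
    have h2 : (#(G.edgeFinset \ R.edgeFinset) : ℝ) = #G.edgeFinset - #R.edgeFinset :=
      Finset.cast_card_sdiff (SimpleGraph.edgeFinset_mono hle)
    rw [IsApproxHom]
    have h3 : (({e : Sym2 V | e ∈ G.edgeSet ∧ e.map
        (fun v ↦ (⟨P.part v, P.part_mem.2 (mem_univ v)⟩ : P.parts)) ∉ Γ.edgeSet}.ncard : ℕ) : ℝ)
        ≤ #(G.edgeFinset \ R.edgeFinset) := Nat.cast_le.2 h1
    push_cast at key
    linarith

theorem cliqueFree_three_iff_homFree {V : Type*} (G : SimpleGraph V) :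
    G.CliqueFree 3 ↔ HomFree (SimpleGraph.completeGraph (Fin 3)) G := by
  rw [SimpleGraph.cliqueFree_iff, HomFree]
  constructor
  · rintro ⟨h⟩
    exact ⟨fun f ↦ h ⟨f, SimpleGraph.Hom.injective_of_top_hom f⟩⟩
  · rintro ⟨h⟩
    exact ⟨fun f ↦ h f.toHom⟩

/-- If `H` maps to a triangle, then `H`-hom-free graphs are triangle-free, so the set of
admissible bounds for them is nonempty. -/
theorem approxHomBounds_nonempty {B : Type*} (H : SimpleGraph B)
    (h : H →g SimpleGraph.completeGraph (Fin 3)) {ε : ℝ} (hε : 0 < ε) (hε1 : ε ≤ 1) :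
    (approxHomBounds (SimpleGraph.completeGraph (Fin 3)) H ε).Nonempty := by
  refine ⟨max ⌈4 / ε⌉₊ (SzemerediRegularity.bound (ε / 8) ⌈4 / ε⌉₊), fun V _ G hG ↦ ?_⟩
  have hG3 : G.CliqueFree 3 := by
    rw [cliqueFree_three_iff_homFree]
    exact ⟨fun f ↦ hG.false (f.comp h)⟩
  obtain ⟨W, _, Γ, h1, h2, h3⟩ := exists_isApproxHom_of_cliqueFree hε hε1 V G hG3
  exact ⟨W, _, Γ, (cliqueFree_three_iff_homFree Γ).1 h1, h2, h3⟩

/-! ### Colourings of the cube with few colours -/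

open Finset in
/-- Exponential moment of a signed sum of independent signs. -/
theorem sum_exp_signed_le {F : Type*} [Fintype F] [DecidableEq F] (s : F → ℝ)
    (hs : ∀ t, s t = 1 ∨ s t = -1) (lam : ℝ) :
    ∑ u : F → Bool, Real.exp (lam * ∑ t, s t * (if u t then 1 else -1)) ≤
      2 ^ Fintype.card F * Real.exp (lam ^ 2 / 2 * Fintype.card F) := by
  have h1 : ∀ u : F → Bool, Real.exp (lam * ∑ t, s t * (if u t then 1 else -1)) =
      ∏ t, Real.exp (lam * (s t * (if u t then 1 else -1))) := fun u ↦ by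
    rw [mul_sum, Real.exp_sum]
  simp_rw [h1]
  rw [← Fintype.prod_sum (fun t (b : Bool) ↦ Real.exp (lam * (s t * (if b then 1 else -1))))]
  have h2 : ∀ t, ∑ b : Bool, Real.exp (lam * (s t * (if b then 1 else -1))) ≤
      2 * Real.exp (lam ^ 2 / 2) := fun t ↦ by
    have := Real.cosh_le_exp_half_sq lam
    rw [Real.cosh_eq] at this
    rcases hs t with h | h <;> simp [h] <;> linarith
  calc _ ≤ ∏ _t : F, 2 * Real.exp (lam ^ 2 / 2) :=
        prod_le_prod (fun t _ ↦ by positivity) (fun t _ ↦ h2 t)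
    _ = _ := by
        rw [prod_const, mul_pow, ← Real.exp_nat_mul, card_univ, mul_comm (lam ^ 2 / 2)]

open Finset in
/-- A colouring of the discrete cube with `exp (o(q))` colours is almost independent of most
coordinates: summed over the coordinates `t`, the total variation distance between the colour
distributions on the two halves `u t = true` and `u t = false` is `o(q)`. With the signs `s w t`
chosen to be those of the biases of the colour classes, the sum becomes the mean over `u` of
`∑ t, s (f u) t * u t`, which is at most the mean of a maximum of few sub-Gaussian variables. -/
theorem sum_abs_card_sub_card_le {F W : Type*} [Fintype F] [DecidableEq F] [Fintype W]
    [DecidableEq W] [Nonempty W] (f : (F → Bool) → W) {lam : ℝ} (hlam : 0 < lam) :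
    ∑ t, ∑ w, |(#{u : F → Bool | f u = w ∧ u t = true} : ℝ) - #{u | f u = w ∧ u t = false}| ≤
      2 ^ Fintype.card F *
        ((Real.log (Fintype.card W) + lam ^ 2 / 2 * Fintype.card F) / lam) := by
  set q := Fintype.card F
  set D : F → W → ℝ := fun t w ↦
    (#{u : F → Bool | f u = w ∧ u t = true} : ℝ) - #{u | f u = w ∧ u t = false} with hD
  set s : W → F → ℝ := fun w t ↦ if 0 ≤ D t w then 1 else -1 with hs
  have hs1 : ∀ w t, s w t = 1 ∨ s w t = -1 := fun w t ↦ by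
    simp only [hs]; split_ifs <;> simp
  have habs : ∀ t w, |D t w| = s w t * D t w := fun t w ↦ by
    simp only [hs]
    split_ifs with h
    · rw [abs_of_nonneg h, one_mul]
    · rw [abs_of_neg (not_le.1 h), neg_one_mul]
  have hDsum : ∀ t w, D t w = ∑ u : F → Bool, if f u = w then (if u t then 1 else -1) else 0 :=
    fun t w ↦ by
    simp only [hD, card_filter, Nat.cast_sum, ← sum_sub_distrib]
    refine sum_congr rfl fun u _ ↦ ?_
    by_cases h : f u = w <;> cases h' : u t <;> simp [h]
  -- `X u` is the signed coordinate sum of `u`, with the signs belonging to the colour of `u`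
  set X : (F → Bool) → ℝ := fun u ↦ ∑ t, s (f u) t * (if u t then 1 else -1) with hX
  have hmain : ∑ t, ∑ w, |D t w| = ∑ u, X u := by
    simp only [habs, hX]
    rw [sum_comm (s := univ (α := F → Bool))]
    refine sum_congr rfl fun t _ ↦ ?_
    simp only [hDsum, mul_sum]
    rw [sum_comm]
    refine sum_congr rfl fun u _ ↦ ?_
    simp
  change ∑ t, ∑ w, |D t w| ≤ _
  rw [hmain]
  set m : ℝ := ((Fintype.card W : ℕ) : ℝ) with hm
  have hm0 : 0 < m := Nat.cast_pos.2 Fintype.card_pos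
  set K := Real.log m + lam ^ 2 / 2 * q with hK
  have hexp : ∑ u, Real.exp (lam * X u) ≤ 2 ^ q * Real.exp K := by
    calc ∑ u, Real.exp (lam * X u)
        ≤ ∑ u : F → Bool, ∑ w, Real.exp (lam * ∑ t, s w t * (if u t then 1 else -1)) :=
          sum_le_sum fun u _ ↦ single_le_sum
            (f := fun w ↦ Real.exp (lam * ∑ t, s w t * (if u t then 1 else -1)))
            (fun w _ ↦ (Real.exp_pos _).le) (mem_univ (f u))
      _ = ∑ w, ∑ u : F → Bool, Real.exp (lam * ∑ t, s w t * (if u t then 1 else -1)) := sum_comm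
      _ ≤ ∑ _w : W, 2 ^ q * Real.exp (lam ^ 2 / 2 * q) :=
          sum_le_sum fun w _ ↦ sum_exp_signed_le (s w) (hs1 w) lam
      _ = 2 ^ q * Real.exp K := by
          rw [sum_const, card_univ, nsmul_eq_mul, hK, Real.exp_add, Real.exp_log hm0]
          ring
  -- Jensen's inequality in tangent form: `x ≤ K - 1 + exp (x - K)`
  have htan : ∀ u, lam * X u ≤ (K - 1) + Real.exp (lam * X u) * Real.exp (-K) := fun u ↦ by
    have := Real.add_one_le_exp (lam * X u - K)
    rw [sub_eq_add_neg, Real.exp_add] at this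
    linarith
  have hsum : lam * ∑ u, X u ≤ 2 ^ q * K := by
    calc lam * ∑ u, X u = ∑ u, lam * X u := mul_sum _ _ _
      _ ≤ ∑ u : F → Bool, ((K - 1) + Real.exp (lam * X u) * Real.exp (-K)) :=
          sum_le_sum fun u _ ↦ htan u
      _ = 2 ^ q * (K - 1) + (∑ u, Real.exp (lam * X u)) * Real.exp (-K) := by
          rw [sum_add_distrib, sum_const, ← sum_mul, card_univ, Fintype.card_fun,
            Fintype.card_bool, nsmul_eq_mul]
          push_cast
          rfl
      _ ≤ 2 ^ q * (K - 1) + 2 ^ q * Real.exp K * Real.exp (-K) := by gcongr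
      _ = 2 ^ q * K := by
          rw [mul_assoc (2 ^ q), ← Real.exp_add, add_neg_cancel, Real.exp_zero]
          ring
  rw [← mul_div_assoc, le_div_iff₀ hlam]
  linarith

/-! ### Odd girth -/

/-- The hyperedges of the linear hypergraph are the pairs `(a, z)` of coordinate vectors; the
vertices are lines, in three classes. The line of class `c` through `g` consists of the hyperedges
with the same value of `lineOf c` as `g`; along it the coordinate `a c` moves freely. The
coordinate `z c` is tied to the pair of classes `c`, `c + 1` as in the Heisenberg group: it is
constant on lines of the classes `c` and `c + 2`, and changes by `a c` times the change of
`a (c + 1)` on lines of class `c + 1`. -/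
def lineOf {F : Type*} [Ring F] (c : Fin 3) (g : (Fin 3 → F) × (Fin 3 → F)) :
    F × F × F × F × F :=
  (g.1 (c + 1), g.1 (c + 2), g.2 c, g.2 (c + 1), g.2 (c + 2) - g.1 (c + 2) * g.1 c)

/-- Up to rotation and with suitable names for the colours, a proper colouring of the seven-cycle with three colours has one of the
patterns `XYZXYXY`, `XYZXYZY`, `XYZXZXY`. -/
theorem exists_rotation (c : Fin 7 → Fin 3) (hc : ∀ i, c i ≠ c (i + 1)) :
    ∃ r, c (r + 0) ≠ c (r + 1) ∧ c (r + 0) ≠ c (r + 2) ∧ c (r + 1) ≠ c (r + 2) ∧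
      c (r + 3) = c (r + 0) ∧ (
      (c (r + 4) = c (r + 1) ∧ c (r + 5) = c (r + 0) ∧ c (r + 6) = c (r + 1)) ∨
      (c (r + 4) = c (r + 1) ∧ c (r + 5) = c (r + 2) ∧ c (r + 6) = c (r + 1)) ∨
      (c (r + 4) = c (r + 2) ∧ c (r + 5) = c (r + 0) ∧ c (r + 6) = c (r + 1))) := by
  have key : ∀ c0 c1 c2 c3 c4 c5 c6 : Fin 3, c0 ≠ c1 → c1 ≠ c2 → c2 ≠ c3 → c3 ≠ c4 → c4 ≠ c5 →
      c5 ≠ c6 → c6 ≠ c0 → ∃ r : Fin 7, let c := ![c0, c1, c2, c3, c4, c5, c6];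
      c (r + 0) ≠ c (r + 1) ∧ c (r + 0) ≠ c (r + 2) ∧ c (r + 1) ≠ c (r + 2) ∧
      c (r + 3) = c (r + 0) ∧ (
      (c (r + 4) = c (r + 1) ∧ c (r + 5) = c (r + 0) ∧ c (r + 6) = c (r + 1)) ∨
      (c (r + 4) = c (r + 1) ∧ c (r + 5) = c (r + 2) ∧ c (r + 6) = c (r + 1)) ∨
      (c (r + 4) = c (r + 2) ∧ c (r + 5) = c (r + 0) ∧ c (r + 6) = c (r + 1))) := by
    decide +kernel
  have e : c = ![c 0, c 1, c 2, c 3, c 4, c 5, c 6] := by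
    ext i; fin_cases i <;> rfl
  obtain ⟨r, hr⟩ := key (c 0) (c 1) (c 2) (c 3) (c 4) (c 5) (c 6) (hc 0) (hc 1) (hc 2) (hc 3)
    (hc 4) (hc 5) (hc 6)
  exact ⟨r, by rw [e]; exact hr⟩

/-- There is no closed walk of length seven through the lines of the hypergraph, with classes
`c i` and with `g i` the hyperedge between the lines `i` and `i + 1`, that stays on a hyperedge at
a line (changes the coordinate of its class by zero) only to return to the class it came from.
The changes for each class add up to zero. In `XYZXYXY` the only change of `Z` is thus zero,
although its neighbours `Y` and `X` differ. In `XYZXYZY` the two changes of `X` and the two of `Z`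
are opposite, nonzero and interlaced, so the coordinate `z` of the pair `X`, `Z` does not close up.
In `XYZXZXY` the changes of `Y`, and those of `Z`, are opposite and nonzero; the coordinates `z` of
`X`, `Y` and `X`, `Z` close up only if the first two changes of `X` vanish, and then so does the
third, which lies between `Z` and `Y`. -/
theorem not_closed_walk_of_pattern {F : Type*} [Field F] (g : Fin 7 → (Fin 3 → F) × (Fin 3 → F))
    (c : Fin 7 → Fin 3)
    (hline : ∀ i, lineOf (c (i + 1)) (g i) = lineOf (c (i + 1)) (g (i + 1)))
    (hturn : ∀ i, (g i).1 (c (i + 1)) = (g (i + 1)).1 (c (i + 1)) → c i = c (i + 2))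
    (X Y Z : Fin 3) (hXY : X ≠ Y) (hXZ : X ≠ Z) (hYZ : Y ≠ Z)
    (h0 : c 0 = X) (h1 : c 1 = Y) (h2 : c 2 = Z) (h3 : c 3 = X)
    (h : (c 4 = Y ∧ c 5 = X ∧ c 6 = Y) ∨ (c 4 = Y ∧ c 5 = Z ∧ c 6 = Y) ∨
      (c 4 = Z ∧ c 5 = X ∧ c 6 = Y)) : False := by
  have l0 := hline 0
  have l1 := hline 1
  have l2 := hline 2
  have l3 := hline 3
  have l4 := hline 4
  have l5 := hline 5
  have l6 := hline 6
  have t0 := hturn 0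
  have t1 := hturn 1
  have t2 := hturn 2
  have t3 := hturn 3
  have t4 := hturn 4
  have t5 := hturn 5
  have t6 := hturn 6
  clear hline hturn
  have perm : ∀ X Y Z : Fin 3, X ≠ Y → X ≠ Z → Y ≠ Z → (X = 0 ∧ Y = 1 ∧ Z = 2) ∨
      (X = 0 ∧ Y = 2 ∧ Z = 1) ∨ (X = 1 ∧ Y = 0 ∧ Z = 2) ∨ (X = 1 ∧ Y = 2 ∧ Z = 0) ∨
      (X = 2 ∧ Y = 0 ∧ Z = 1) ∨ (X = 2 ∧ Y = 1 ∧ Z = 0) := by decide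
  rcases perm X Y Z hXY hXZ hYZ with ⟨rfl, rfl, rfl⟩ | ⟨rfl, rfl, rfl⟩ | ⟨rfl, rfl, rfl⟩ |
    ⟨rfl, rfl, rfl⟩ | ⟨rfl, rfl, rfl⟩ | ⟨rfl, rfl, rfl⟩ <;>
  rcases h with ⟨h4, h5, h6⟩ | ⟨h4, h5, h6⟩ | ⟨h4, h5, h6⟩ <;>
  simp [h0, h1, h2, h3, h4, h5, h6, lineOf] at * <;>
  grind

theorem not_closed_walk {F : Type*} [Field F] (g : Fin 7 → (Fin 3 → F) × (Fin 3 → F))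
    (c : Fin 7 → Fin 3) (hc : ∀ i, c i ≠ c (i + 1))
    (hline : ∀ i, lineOf (c (i + 1)) (g i) = lineOf (c (i + 1)) (g (i + 1)))
    (hturn : ∀ i, (g i).1 (c (i + 1)) = (g (i + 1)).1 (c (i + 1)) → c i = c (i + 2)) :
    False := by
  obtain ⟨r, h01, h02, h12, h30, h⟩ := exists_rotation c hc
  refine not_closed_walk_of_pattern (fun i ↦ g (r + i)) (fun i ↦ c (r + i)) (fun i ↦ ?_)
    (fun i ↦ ?_) (c (r + 0)) (c (r + 1)) (c (r + 2)) h01 h02 h12 rfl rfl rfl h30 h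
  · simpa only [add_assoc] using hline (r + i)
  · simpa only [add_assoc] using hturn (r + i)

/-- The class to which a vertex of class `c` points: `c + 1` for `true`, `c + 2` for `false`. -/
def target (c : Fin 3) (b : Bool) : Fin 3 := c + if b then 1 else 2

/-- The vertices are triples `(c, x, u)` of a class, a line `x` of that class and a function `u`
choosing, for each hyperedge of the line, one of the two other classes; the hyperedges of a line of
class `c` are indexed by their coordinate `a c`. Two vertices of different classes are adjacent
when their lines share a hyperedge for which each chooses the class of the other. A walk which
enters and leaves a vertex by the same hyperedge thus returns to the class it came from; in
particular it cannot go around a single hyperedge. -/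
def choiceGraph (F : Type*) [Ring F] :
    SimpleGraph (Fin 3 × (F × F × F × F × F) × (F → Bool)) where
  Adj v w := v.1 ≠ w.1 ∧ ∃ g, lineOf v.1 g = v.2.1 ∧ lineOf w.1 g = w.2.1 ∧
    w.1 = target v.1 (v.2.2 (g.1 v.1)) ∧ v.1 = target w.1 (w.2.2 (g.1 w.1))
  symm := ⟨fun _ _ ⟨h, g, h1, h2, h3, h4⟩ ↦ ⟨h.symm, g, h2, h1, h4, h3⟩⟩
  loopless := ⟨fun _ h ↦ h.1 rfl⟩

theorem homFree_seven_choiceGraph (F : Type*) [Field F] :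
    HomFree (SimpleGraph.cycleGraph 7) (choiceGraph F) := by
  refine ⟨fun f ↦ ?_⟩
  have hadj : ∀ i : Fin 7, (SimpleGraph.cycleGraph 7).Adj i (i + 1) := by
    intro i
    rw [SimpleGraph.cycleGraph_adj]
    right
    exact add_sub_cancel_left i 1
  have hG := fun i ↦ f.map_adj (hadj i)
  choose hc g h1 h2 h3 h4 using hG
  refine not_closed_walk g (fun i ↦ (f i).1) hc (fun i ↦ ?_) (fun i h ↦ ?_)
  · exact (h2 i).trans (h1 (i + 1)).symm
  · have e1 := h4 i
    have e2 := h3 (i + 1)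
    rw [h] at e1
    rw [e1, ← e2, add_assoc]
    rfl

theorem homFree_choiceGraph (F : Type*) [Field F] {ℓ : ℕ} (hℓ : ℓ = 5 ∨ ℓ = 7) :
    HomFree (SimpleGraph.cycleGraph ℓ) (choiceGraph F) := by
  rcases hℓ with rfl | rfl
  · have h : SimpleGraph.cycleGraph 7 →g SimpleGraph.cycleGraph 5 :=
      ⟨![0, 1, 2, 3, 4, 3, 4], by
        intro a b; revert a b; simp only [SimpleGraph.cycleGraph_adj]; decide⟩
    exact ⟨fun f ↦ (homFree_seven_choiceGraph F).false (f.comp h)⟩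
  · exact homFree_seven_choiceGraph F

theorem nonempty_hom_triangle {ℓ : ℕ} (hℓ : ℓ = 5 ∨ ℓ = 7) :
    Nonempty (SimpleGraph.cycleGraph ℓ →g SimpleGraph.completeGraph (Fin 3)) := by
  rcases hℓ with rfl | rfl
  · exact ⟨⟨![0, 1, 0, 1, 2], by
      intro a b; revert a b; simp only [SimpleGraph.cycleGraph_adj, SimpleGraph.top_adj]; decide⟩⟩
  · exact ⟨⟨![0, 1, 0, 1, 0, 1, 2], by
      intro a b; revert a b; simp only [SimpleGraph.cycleGraph_adj, SimpleGraph.top_adj]; decide⟩⟩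

/-! ### Counting lost edges -/

open Finset in
/-- Replacing the uniform distribution on `P'` by that on `Q'` changes the number of pairs with
non-adjacent images by at most the distance of the two image distributions. -/
theorem sum_nonadj_le {U W : Type*} [DecidableEq U] [Fintype W] [DecidableEq W]
    (I : W → W → ℝ) (hI0 : ∀ x y, 0 ≤ I x y) (hI1 : ∀ x y, I x y ≤ 1) (α β : U → W)
    (P P' Q' : Finset U) :
    ∑ u ∈ P, ∑ v ∈ P', I (α u) (β v) ≤ ∑ u ∈ P, ∑ v ∈ Q', I (α u) (β v) +
      #P * ∑ w, |(#{v ∈ P' | β v = w} : ℝ) - #{v ∈ Q' | β v = w}| := by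
  rw [← nsmul_eq_mul, ← sum_const, ← sum_add_distrib]
  refine sum_le_sum fun u _ ↦ ?_
  have fib : ∀ S : Finset U, ∑ v ∈ S, I (α u) (β v) = ∑ w, (#{v ∈ S | β v = w} : ℝ) * I (α u) w :=
    fun S ↦ by
    rw [← sum_fiberwise S β]
    refine sum_congr rfl fun w _ ↦ ?_
    rw [← nsmul_eq_mul, ← sum_const]
    refine sum_congr rfl fun v hv ↦ ?_
    rw [(mem_filter.1 hv).2]
  rw [fib, fib, ← sum_add_distrib]
  refine sum_le_sum fun w _ ↦ ?_
  have h1 := le_abs_self ((#{v ∈ P' | β v = w} : ℝ) - #{v ∈ Q' | β v = w})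
  have h2 := abs_nonneg ((#{v ∈ P' | β v = w} : ℝ) - #{v ∈ Q' | β v = w})
  nlinarith [hI0 (α u) w, hI1 (α u) w]

open Finset in
/-- If `Γ` is triangle-free, then among three independent random points of `W` some cyclically
consecutive two are non-adjacent. Here the points of `P c` and `Q c` stand for the vertices of
class `c` pointing forward and backward at a fixed hyperedge, so that the pairs counted on the
right are lost edges of the choice graph. -/
theorem sq_le_sum_nonadj {U W : Type*} [DecidableEq U] [Fintype W] [DecidableEq W]
    (Γ : SimpleGraph W) [DecidableRel Γ.Adj] (hΓ : Γ.CliqueFree 3) (φ : Fin 3 → U → W)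
    (P Q : Fin 3 → Finset U) {H : ℝ} (hH : 0 < H) (hP : ∀ c, (#(P c) : ℝ) = H) :
    H ^ 2 ≤ ∑ c, (∑ u ∈ P c, ∑ v ∈ Q (c + 1),
        (if Γ.Adj (φ c u) (φ (c + 1) v) then (0 : ℝ) else 1) +
      H * ∑ w, |(#{v ∈ P (c + 1) | φ (c + 1) v = w} : ℝ) -
        #{v ∈ Q (c + 1) | φ (c + 1) v = w}|) := by
  set I : W → W → ℝ := fun x y ↦ if Γ.Adj x y then 0 else 1 with hI
  have hI0 : ∀ x y, 0 ≤ I x y := fun x y ↦ by simp only [hI]; split_ifs <;> norm_num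
  have hI1 : ∀ x y, I x y ≤ 1 := fun x y ↦ by simp only [hI]; split_ifs <;> norm_num
  have htri : ∀ x y z, 1 ≤ I x y + I y z + I z x := fun x y z ↦ by
    by_contra! h
    refine hΓ {x, y, z} (SimpleGraph.is3Clique_triple_iff.2 ?_)
    simp only [hI] at h
    split_ifs at h with h1 h2 h3 <;> norm_num at h
    exact ⟨h1, h3.symm, h2⟩
  have hsum : H ^ 3 ≤ H * ∑ c, ∑ u ∈ P c, ∑ v ∈ P (c + 1), I (φ c u) (φ (c + 1) v) := by
    calc H ^ 3 = ∑ u ∈ P 0, ∑ v ∈ P 1, ∑ w ∈ P 2, (1 : ℝ) := by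
          simp only [sum_const, nsmul_eq_mul, hP]; ring
      _ ≤ ∑ u ∈ P 0, ∑ v ∈ P 1, ∑ w ∈ P 2,
          (I (φ 0 u) (φ 1 v) + I (φ 1 v) (φ 2 w) + I (φ 2 w) (φ 0 u)) :=
          sum_le_sum fun _ _ ↦ sum_le_sum fun _ _ ↦ sum_le_sum fun _ _ ↦ htri _ _ _
      _ = _ := by
          simp only [sum_add_distrib, sum_const, nsmul_eq_mul, hP, ← mul_sum]
          rw [Fin.sum_univ_three, sum_comm (s := P 0) (t := P 2)]
          simp only [zero_add, Fin.reduceAdd]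
          ring
  have hsq : H ^ 2 ≤ ∑ c, ∑ u ∈ P c, ∑ v ∈ P (c + 1), I (φ c u) (φ (c + 1) v) := by
    refine le_of_mul_le_mul_left ?_ hH
    calc H * H ^ 2 = H ^ 3 := by ring
      _ ≤ _ := hsum
  refine hsq.trans (sum_le_sum fun c _ ↦ ?_)
  rw [← hP c]
  exact sum_nonadj_le I hI0 hI1 (φ c) (φ (c + 1)) (P c) (P (c + 1)) (Q (c + 1))

theorem lineOf_bijective (F : Type*) [Field F] [Fintype F] (c : Fin 3) :
    Function.Bijective fun g : (Fin 3 → F) × (Fin 3 → F) ↦ (lineOf c g, g.1 c) := by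
  classical
  rw [Fintype.bijective_iff_injective_and_card]
  have hd : ∀ c d : Fin 3, d = c ∨ d = c + 1 ∨ d = c + 2 := by decide
  refine ⟨fun g g' h ↦ ?_, ?_⟩
  · simp only [lineOf, Prod.mk.injEq] at h
    obtain ⟨⟨h1, h2, h3, h4, h5⟩, h6⟩ := h
    rw [h2, h6, sub_left_inj] at h5
    ext d <;> rcases hd c d with rfl | rfl | rfl <;> assumption
  · simp only [Fintype.card_prod, Fintype.card_fun, Fintype.card_fin]
    ring

/-- Two lines of different classes meet in at most one hyperedge. -/
theorem eq_of_lineOf_eq {F : Type*} [Field F] (c : Fin 3) {g g' : (Fin 3 → F) × (Fin 3 → F)}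
    (h : lineOf c g = lineOf c g') (h' : lineOf (c + 1) g = lineOf (c + 1) g') : g = g' := by
  have hd : ∀ c d : Fin 3, d = c ∨ d = c + 1 ∨ d = c + 2 := by decide
  have e : ∀ c : Fin 3, c + 1 + 2 = c ∧ c + 1 + 1 = c + 2 := by decide
  simp only [lineOf, Prod.mk.injEq, (e c).1, (e c).2] at h h'
  obtain ⟨h1, h2, h3, h4, h5⟩ := h
  obtain ⟨-, h6, -, -, -⟩ := h'
  rw [h2, h6, sub_left_inj] at h5
  ext d <;> rcases hd c d with rfl | rfl | rfl <;> assumption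

open Finset in
theorem two_mul_card_filter_apply_eq {F : Type*} [Fintype F] [DecidableEq F] (t : F) (b : Bool) :
    2 * #{u : F → Bool | u t = b} = 2 ^ Fintype.card F := by
  have h : #{u : F → Bool | u t = b} = #{u : F → Bool | ¬ u t = b} := by
    refine card_bij' (fun u _ ↦ Function.update u t (!u t)) (fun u _ ↦ Function.update u t (!u t))
      ?_ ?_ ?_ ?_ <;> intro u hu <;> cases b <;> simp_all
  have h2 := card_filter_add_card_filter_not (s := (univ : Finset (F → Bool))) (fun u ↦ u t = b)
  rw [card_univ, Fintype.card_fun, Fintype.card_bool] at h2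
  omega

open Finset in
/-- Distinct choices of a hyperedge, two consecutive classes and vertices of these pointing to
each other give distinct edges of the choice graph. -/
theorem sum_nonadj_le_ncard {F W : Type*} [Field F] [Fintype F] [DecidableEq F]
    (Γ : SimpleGraph W) [DecidableRel Γ.Adj]
    (φ : Fin 3 × (F × F × F × F × F) × (F → Bool) → W) :
    ∑ g : (Fin 3 → F) × (Fin 3 → F), ∑ c : Fin 3,
      ∑ u : F → Bool with u (g.1 c) = true, ∑ v : F → Bool with v (g.1 (c + 1)) = false,
        (if Γ.Adj (φ (c, lineOf c g, u)) (φ (c + 1, lineOf (c + 1) g, v)) then (0 : ℝ) else 1) ≤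
      ({e | e ∈ (choiceGraph F).edgeSet ∧ e.map φ ∉ Γ.edgeSet}.ncard : ℝ) := by
  set T : Finset (((Fin 3 → F) × (Fin 3 → F)) × Fin 3 × (F → Bool) × (F → Bool)) :=
    {x | x.2.2.1 (x.1.1 x.2.1) = true ∧ x.2.2.2 (x.1.1 (x.2.1 + 1)) = false ∧
      ¬ Γ.Adj (φ (x.2.1, lineOf x.2.1 x.1, x.2.2.1))
        (φ (x.2.1 + 1, lineOf (x.2.1 + 1) x.1, x.2.2.2))} with hT
  have hcard : ∑ g : (Fin 3 → F) × (Fin 3 → F), ∑ c : Fin 3,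
      ∑ u : F → Bool with u (g.1 c) = true, ∑ v : F → Bool with v (g.1 (c + 1)) = false,
        (if Γ.Adj (φ (c, lineOf c g, u)) (φ (c + 1, lineOf (c + 1) g, v)) then (0 : ℝ) else 1) =
      #T := by
    rw [hT, card_filter, Nat.cast_sum]
    refine Eq.trans ?_ (Fintype.sum_prod_type _).symm
    refine sum_congr rfl fun g _ ↦ ?_
    rw [Fintype.sum_prod_type]
    refine sum_congr rfl fun c _ ↦ ?_
    rw [Fintype.sum_prod_type, sum_filter]
    refine sum_congr rfl fun u _ ↦ ?_
    rw [sum_filter]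
    by_cases h1 : u (g.1 c) = true
    · rw [if_pos h1]
      refine sum_congr rfl fun v _ ↦ ?_
      by_cases h2 : v (g.1 (c + 1)) = false <;> simp [h1, h2]
    · simp [h1]
  rw [hcard, ← Set.ncard_coe_finset]
  refine Nat.cast_le.2 (Set.ncard_le_ncard_of_injOn
    (fun x ↦ s((x.2.1, lineOf x.2.1 x.1, x.2.2.1),
      (x.2.1 + 1, lineOf (x.2.1 + 1) x.1, x.2.2.2))) ?_ ?_ (Set.toFinite _))
  · rintro ⟨g, c, u, v⟩ hx
    simp only [hT, coe_filter, mem_univ, true_and, Set.mem_ofPred_eq] at hx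
    obtain ⟨h1, h2, h3⟩ := hx
    refine ⟨?_, h3⟩
    have e1 : ∀ c : Fin 3, c ≠ c + 1 ∧ c = target (c + 1) false := by decide
    refine ⟨(e1 c).1, g, rfl, rfl, by simp [target, h1], ?_⟩
    change c = target (c + 1) (v (g.1 (c + 1)))
    rw [h2]
    exact (e1 c).2
  · rintro ⟨g, c, u, v⟩ - ⟨g', c', u', v'⟩ - h
    rcases Sym2.eq_iff.1 h with ⟨h1, h2⟩ | ⟨h1, h2⟩
    · simp only [Prod.mk.injEq] at h1 h2
      obtain ⟨rfl, h3, rfl⟩ := h1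
      obtain ⟨-, h4, rfl⟩ := h2
      rw [eq_of_lineOf_eq c h3 h4]
    · simp only [Prod.mk.injEq] at h1 h2
      have e : ∀ c c' : Fin 3, c = c' + 1 → c + 1 = c' → False := by decide
      exact (e c c' h1.1 h2.1).elim

open Finset in
/-- An approximate homomorphism from the choice graph to a triangle-free graph loses many edges or
uses many vertices. -/
theorem one_le_of_isApproxHom {F W : Type*} [Field F] [Fintype F] [DecidableEq F] [Fintype W]
    (Γ : SimpleGraph W) (hΓ : Γ.CliqueFree 3) {ε : ℝ}
    (φ : Fin 3 × (F × F × F × F × F) × (F → Bool) → W)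
    (hφ : IsApproxHom ε (choiceGraph F) Γ φ) {lam : ℝ} (hlam : 0 < lam) :
    1 ≤ 36 * ε * (Fintype.card F : ℝ) ^ 4 + 6 * ((Real.log (Fintype.card W) +
      lam ^ 2 / 2 * Fintype.card F) / lam / Fintype.card F) := by
  classical
  have : Nonempty W := ⟨φ (0, 0, fun _ ↦ true)⟩
  set q : ℝ := ((Fintype.card F : ℕ) : ℝ) with hq
  have hq0 : 0 < q := Nat.cast_pos.2 Fintype.card_pos
  set B : ℝ := (Real.log (Fintype.card W) + lam ^ 2 / 2 * q) / lam with hB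
  set H : ℝ := 2 ^ Fintype.card F / 2 with hH
  have hH0 : 0 < H := by positivity
  have hhalf : ∀ (t : F) (b : Bool), (#{u : F → Bool | u t = b} : ℝ) = H := fun t b ↦ by
    have := congrArg (Nat.cast (R := ℝ)) (two_mul_card_filter_apply_eq t b)
    push_cast at this
    rw [hH]
    linarith
  set E := (Fin 3 → F) × (Fin 3 → F)
  let D : Fin 3 → (F × F × F × F × F) × F → ℝ := fun c y ↦
    ∑ w, |(#{u : F → Bool | φ (c, y.1, u) = w ∧ u y.2 = true} : ℝ) -
      #{u : F → Bool | φ (c, y.1, u) = w ∧ u y.2 = false}|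
  have hD : ∀ c, ∑ g : E, D c (lineOf c g, g.1 c) ≤ q ^ 5 * (2 * H * B) := fun c ↦ by
    rw [(lineOf_bijective F c).sum_comp (D c), Fintype.sum_prod_type]
    calc ∑ x, ∑ t, D c (x, t) ≤ ∑ _x : F × F × F × F × F, 2 * H * B := by
          refine sum_le_sum fun x _ ↦ ?_
          have := sum_abs_card_sub_card_le (fun u ↦ φ (c, x, u)) hlam
          calc _ ≤ _ := this
            _ = 2 * H * B := by rw [hH, hB]; ring
      _ = q ^ 5 * (2 * H * B) := by
          rw [sum_const, card_univ, nsmul_eq_mul]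
          simp only [Fintype.card_prod]
          push_cast
          ring
  have hg : ∀ g : E, H ^ 2 ≤ ∑ c, (∑ u : F → Bool with u (g.1 c) = true,
      ∑ v : F → Bool with v (g.1 (c + 1)) = false,
        (if Γ.Adj (φ (c, lineOf c g, u)) (φ (c + 1, lineOf (c + 1) g, v)) then (0 : ℝ) else 1)) +
      H * ∑ c, D c (lineOf c g, g.1 c) := fun g ↦ by
    have := sq_le_sum_nonadj Γ hΓ (fun c u ↦ φ (c, lineOf c g, u))
      (fun c ↦ {u : F → Bool | u (g.1 c) = true}) (fun c ↦ {u : F → Bool | u (g.1 c) = false})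
      hH0 (fun c ↦ hhalf (g.1 c) true)
    rw [sum_add_distrib, ← mul_sum] at this
    refine this.trans (le_of_eq ?_)
    congr 2
    rw [← Equiv.sum_comp (Equiv.addRight (1 : Fin 3)) (fun c ↦ D c (lineOf c g, g.1 c))]
    simp only [D, filter_filter, Equiv.coe_addRight, and_comm]
  have htot := sum_le_sum fun (g : E) (_ : g ∈ univ) ↦ hg g
  rw [sum_const, card_univ, nsmul_eq_mul, sum_add_distrib, ← mul_sum, sum_comm (f := fun g c ↦
    D c (lineOf c g, g.1 c))] at htot
  have h1 := (sum_nonadj_le_ncard Γ φ).trans hφ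
  have h2 : ∑ c, ∑ g : E, D c (lineOf c g, g.1 c) ≤ 3 * (q ^ 5 * (2 * H * B)) := by
    refine (sum_le_sum fun c _ ↦ hD c).trans (le_of_eq ?_)
    simp
  have hE : ((Fintype.card E : ℕ) : ℝ) = q ^ 6 := by
    simp only [E, Fintype.card_prod, Fintype.card_fun, Fintype.card_fin]
    push_cast
    ring
  have hV : ((Fintype.card (Fin 3 × (F × F × F × F × F) × (F → Bool)) : ℕ) : ℝ) =
      3 * q ^ 5 * (2 * H) := by
    simp only [Fintype.card_prod, Fintype.card_fun, Fintype.card_fin, Fintype.card_bool]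
    push_cast
    rw [hH]
    ring
  rw [hV] at h1
  rw [hE] at htot
  have h3 := mul_le_mul_of_nonneg_left h2 hH0.le
  have h4 : q ^ 6 * H ^ 2 * 1 ≤ q ^ 6 * H ^ 2 * (36 * ε * q ^ 4 + 6 * (B / q)) := by
    have : q ^ 6 * H ^ 2 * (36 * ε * q ^ 4 + 6 * (B / q)) =
        ε * (3 * q ^ 5 * (2 * H)) ^ 2 + H * (3 * (q ^ 5 * (2 * H * B))) := by
      field_simp
      ring
    rw [this]
    linarith
  exact le_of_mul_le_mul_left h4 (by positivity)

/-! ### The lower bound -/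

theorem mem_approxHomBounds_le {ℓ : ℕ} (hℓ : ℓ = 5 ∨ ℓ = 7) {p M : ℕ} (hp : p.Prime) {ε : ℝ}
    (hεp : 144 * ε * (p : ℝ) ^ 4 ≤ 1)
    (hM : M ∈ approxHomBounds (SimpleGraph.completeGraph (Fin 3)) (SimpleGraph.cycleGraph ℓ) ε) :
    Real.exp ((p : ℝ) / 144) ≤ M := by
  have : Fact p.Prime := ⟨hp⟩
  obtain ⟨W, _, Γ, hΓ, hW, φ, hφ⟩ := hM _ (choiceGraph (ZMod p)) (homFree_choiceGraph (ZMod p) hℓ)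
  have key := one_le_of_isApproxHom Γ ((cliqueFree_three_iff_homFree Γ).2 hΓ) φ hφ
    (lam := 1 / 12) (by norm_num)
  have : Nonempty W := ⟨φ (0, 0, fun _ ↦ true)⟩
  have hp0 : (0 : ℝ) < p := Nat.cast_pos.2 hp.pos
  have hm0 : (0 : ℝ) < Fintype.card W := Nat.cast_pos.2 Fintype.card_pos
  rw [ZMod.card] at key
  have e : 6 * ((Real.log (Fintype.card W) + (1 / 12) ^ 2 / 2 * (p : ℝ)) / (1 / 12) / p) =
      72 * (Real.log (Fintype.card W) / p) + 1 / 4 := by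
    field_simp
    ring
  rw [e] at key
  have h1 : 1 / 144 ≤ Real.log (Fintype.card W) / p := by linarith
  rw [le_div_iff₀ hp0] at h1
  calc Real.exp ((p : ℝ) / 144) ≤ Fintype.card W := by
        rw [← Real.le_log_iff_exp_le hm0]
        linarith
    _ ≤ M := Nat.cast_le.2 hW

/-- By Bertrand's postulate, there is a prime `p` of the order of `ε ^ (-1 / 4)`; in terms of
`y = ε ^ (-1 / 8)` it exceeds `y` by a large constant factor. -/
theorem exists_prime_of_small {ε : ℝ} (hε : 0 < ε) (hε0 : ε < (1 / 1200) ^ 8) :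
    ∃ p : ℕ, p.Prime ∧ 144 * ε * (p : ℝ) ^ 4 ≤ 1 ∧ 144 * (1 / ε) ^ (1 / 8 : ℝ) ≤ p := by
  set y : ℝ := (1 / ε) ^ (1 / 8 : ℝ) with hy
  have hy0 : 0 < y := by positivity
  have hy8 : y ^ 8 = 1 / ε := by
    rw [hy, ← Real.rpow_natCast, ← Real.rpow_mul (by positivity)]
    norm_num
  have hyl : 1200 ≤ y := by
    refine le_of_pow_le_pow_left₀ (n := 8) (by norm_num) hy0.le ?_
    rw [hy8, le_div_iff₀ hε]
    calc (1200 : ℝ) ^ 8 * ε ≤ 1200 ^ 8 * (1 / 1200) ^ 8 := by gcongr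
      _ = 1 := by norm_num
  -- the prime is at most `2 ⌊y² / 8⌋ ≤ y² / 4`, and `144 ≤ 4 ^ 4`
  have hn := Nat.floor_le (a := y ^ 2 / 8) (by positivity)
  have hn' := Nat.lt_floor_add_one (y ^ 2 / 8)
  set n := ⌊y ^ 2 / 8⌋₊
  have hn0 : n ≠ 0 := by
    rintro h
    rw [h] at hn'
    norm_num at hn'
    nlinarith
  obtain ⟨p, hp, hnp, hpn⟩ := Nat.exists_prime_lt_and_le_two_mul n hn0
  have h1 : ((n + 1 : ℕ) : ℝ) ≤ p := Nat.cast_le.2 hnp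
  have h2 : (p : ℝ) ≤ ((2 * n : ℕ) : ℝ) := Nat.cast_le.2 hpn
  push_cast at h1 h2
  refine ⟨p, hp, ?_, by nlinarith⟩
  have h3 : (p : ℝ) ≤ y ^ 2 / 4 := by linarith
  calc 144 * ε * (p : ℝ) ^ 4 ≤ 144 * ε * (y ^ 2 / 4) ^ 4 := by gcongr
    _ = 144 / 256 * (ε * y ^ 8) := by ring
    _ ≤ 1 := by
        rw [hy8, mul_one_div_cancel hε.ne']
        norm_num

theorem corollary1p11 (ℓ : ℕ) (hℓ : ℓ = 5 ∨ ℓ = 7) :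
    ∃ c : ℝ, 0 < c ∧ ∃ ε₀ : ℝ, 0 < ε₀ ∧ ∀ ε : ℝ, 0 < ε → ε < ε₀ →
      (2 : ℝ) ^ ((1 / ε) ^ c) ≤
        (approxHomNumber (SimpleGraph.completeGraph (Fin 3)) (SimpleGraph.cycleGraph ℓ) ε : ℝ) := by
  refine ⟨1 / 8, by norm_num, (1 / 1200) ^ 8, by positivity, fun ε hε hε0 ↦ ?_⟩
  obtain ⟨p, hp, hεp, hyp⟩ := exists_prime_of_small hε hε0
  obtain ⟨h⟩ := nonempty_hom_triangle hℓ
  have hε1 : ε ≤ 1 := hε0.le.trans (by norm_num)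
  have hmem := Nat.sInf_mem (approxHomBounds_nonempty _ h hε hε1)
  refine le_trans ?_ (mem_approxHomBounds_le hℓ hp hεp hmem)
  have hy0 : 0 ≤ (1 / ε) ^ (1 / 8 : ℝ) := by positivity
  calc (2 : ℝ) ^ ((1 / ε) ^ (1 / 8 : ℝ)) ≤ Real.exp 1 ^ ((1 / ε) ^ (1 / 8 : ℝ)) := by
        refine Real.rpow_le_rpow (by norm_num) ?_ hy0
        linarith [Real.add_one_le_exp 1]
    _ = Real.exp ((1 / ε) ^ (1 / 8 : ℝ)) := Real.exp_one_rpow _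
    _ ≤ Real.exp ((p : ℝ) / 144) := Real.exp_le_exp.2 (by linarith)
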